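/- Consider a network given by a finite simple undirected connected graph $G=(V,E)$ with $n\ge 1$ processes and diameter $D$, and let $K>n$. We work in the locally shared memory model with composite atomicity: in a step a non-empty set of enabled processes, chosen by the distributed unfair daemon (no restriction at all), is activated, and every activated process executes atomically one of its enabled rules, reading only its own state and those of its neighbours; each such execution of a rule by a process is one move. Executions are maximal sequences of steps. The network is anonymous: all processes run the same program, without identifiers. Each process $u$ has a status $\mathrm{st}_u\in\{C,RB,RF\}$, a distance $d_u\in\mathbb N$ and a clock $c_u\in\mathbb Z/K\mathbb Z$. Write $N(u)$ for the neighbours of $u$ and $N[u]=N(u)\cup\{u\}$. Let - $\mathrm{ICorrect}(u)$: $c_v\in\{c_u-1,c_u,c_u+1\}$ for all $v\in N(u)$; $\mathrm{Reset}(u)$: $c_u=0$; $\mathrm{Clean}(u)$: $\mathrm{st}_v=C$ for all $v\in N[u]$; - $\mathrm{P_{RB}}(u)$: $\mathrm{st}_u=C$ and some $v\in N(u)$ has $\mathrm{st}_v=RB$; - $\mathrm{P_{RF}}(u)$: $\mathrm{st}_u=RB$, $\mathrm{Reset}(u)$, and each $v\in N(u)$ satisfies ($\mathrm{st}_v=RB$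 and $d_v\le d_u$) or ($\mathrm{st}_v=RF$ and $\mathrm{Reset}(v)$); - $\mathrm{P_C}(u)$: $\mathrm{st}_u=RF$, and each $v\in N[u]$ satisfies $\mathrm{Reset}(v)$ and (($\mathrm{st}_v=RF$ and $d_v\ge d_u$) or $\mathrm{st}_v=C$); - $\mathrm{P_R}(u)$: $\mathrm{P_{RB}}(u)$ fails, and at least one of the following holds: ($\mathrm{st}_u=C$, not $\mathrm{Reset}(u)$, and some $v\in N(u)$ has $\mathrm{st}_v=RF$); ($\mathrm{st}_u\ne C$ and not $\mathrm{Reset}(u)$); ($\mathrm{st}_u=C$ and not $\mathrm{ICorrect}(u)$). The rules of SDR are: if $\mathrm{P_{RB}}(u)$, then $\mathrm{st}_u:=RB$, $d_u:=1+\min\{d_v: v\in N(u),\ \mathrm{st}_v=RB\}$, $c_u:=0$; if $\mathrm{P_{RF}}(u)$, then $\mathrm{st}_u:=RF$; if $\mathrm{P_C}(u)$, then $\mathrm{st}_u:=C$; if $\mathrm{P_R}(u)$, then $\mathrm{st}_u:=RB$, $d_u:=0$, $c_u:=0$. The only rule of U is: if $\mathrm{Clean}(u)$ and $c_v\in\{c_u,c_u+1\}$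 for all $v\in N(u)$, then $c_u:=c_u+1$. The algorithm U$\,\circ\,$SDR has the rules of both. A configuration is normal if $\mathrm{Clean}(u)$ and $\mathrm{ICorrect}(u)$ hold for every process $u$. An execution satisfies the unison specification if at each instant $c_v\in\{c_u-1,c_u,c_u+1\}$ for every two neighbours $u,v$ (safety), and each process increments its clock infinitely often (liveness). **Theorem.** U$\,\circ\,$SDR is self-stabilizing for unison under the distributed unfair daemon, and one can take the normal configurations as the legitimate ones. That is, the set of normal configurations is non-empty and closed under every step, every execution from an arbitrary configuration contains a normal configuration, and every execution that starts in a normal configuration satisfies the unison specification. Every execution reaches a normal configuration within at most $$(3D+3)n^2+(3D+1)(n-1)+1$$ moves. In particular the stabilization time is in $O(D\,n^2)$ moves: there is a constant $B$, independent of the network and of $K$, such that for all networks with $n\ge2$ it is at most $B\,D\,n^2$. -/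

import Mathlib

/-! ### The locally shared memory model with composite atomicity -/

/-- The local program of an anonymous distributed algorithm with local states in `S`. The same
program is run by every process; its guards and actions read only the state of the process and
the states of its neighbours, the latter given without identities, as a multiset. -/
structure Program (S : Type*) where
  /-- labels of the rules -/
  Rule : Type
  /-- guard of a rule, from the own state and the neighbours' states -/
  guard : Rule → S → Multiset S → Prop
  /-- new own state after executing a rule, from the own state and the neighbours' states -/
  action : Rule → S → Multiset S → S

namespace Program

variable {V S : Type*}

/-- The composition of two algorithms: all rules of both, over the union of their variables. -/
def comp (A B : Program S) : Program S where
  Rule := A.Rule ⊕ B.Rule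
  guard r := Sum.elim A.guard B.guard r
  action r := Sum.elim A.action B.action r

open Classical in
/-- The states of the neighbours of `u` in the configuration `γ`. -/
noncomputable def view [Fintype V] (G : SimpleGraph V) (γ : V → S) (u : V) : Multiset S :=
  (Finset.univ.filter fun v => G.Adj u v).val.map γ

/-- Rule `r` is enabled at process `u` in `γ`. -/
def Enabled [Fintype V] (P : Program S) (G : SimpleGraph V) (γ : V → S) (r : P.Rule) (u : V) :
    Prop :=
  P.guard r (γ u) (view G γ u)

/-- No rule is enabled at any process. -/
def Terminal [Fintype V] (P : Program S) (G : SimpleGraph V) (γ : V → S) : Prop :=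
  ∀ u r, ¬ P.Enabled G γ r u

/-- The step `γ ↦ γ'` in which every process `u` with `a u = some r` is activated and executes its
enabled rule `r`, all of them atomically and simultaneously, while the processes with `a u = none`
are not activated. At least one process is activated. -/
def IsStep [Fintype V] (P : Program S) (G : SimpleGraph V) (γ : V → S) (a : V → Option P.Rule)
    (γ' : V → S) : Prop :=
  (∃ u, a u ≠ none) ∧
  (∀ u, a u = none → γ' u = γ u) ∧
  (∀ u r, a u = some r → P.Enabled G γ r u ∧ γ' u = P.action r (γ u) (view G γ u))

/-- A maximal execution under the distributed unfair daemon (no restriction on the sequence of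
activated sets of processes). An execution that ends at a terminal configuration is continued by
repeating this configuration for ever, without any activation. -/
structure Execution [Fintype V] (P : Program S) (G : SimpleGraph V) where
  /-- the configurations -/
  conf : ℕ → V → S
  /-- the rule executed by each process in each step, `none` if it is not activated -/
  rule : ℕ → V → Option P.Rule
  /-- consecutive configurations are related by a step, unless the execution has ended -/
  step : ∀ i, P.IsStep G (conf i) (rule i) (conf (i + 1)) ∨
    (P.Terminal G (conf i) ∧ (∀ u, rule i u = none) ∧ conf (i + 1) = conf i)

/-- The number of moves (rule executions by single processes) before configuration `i`. -/
def Execution.moves [Fintype V] {P : Program S} {G : SimpleGraph V} (e : P.Execution G) (i : ℕ) :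
    ℕ :=
  ∑ j ∈ Finset.range i, (Finset.univ.filter fun u => (e.rule j u).isSome = true).card

/-- `L` is closed by the algorithm. -/
def Closed [Fintype V] (P : Program S) (G : SimpleGraph V) (L : Set (V → S)) : Prop :=
  ∀ γ a γ', P.IsStep G γ a γ' → γ ∈ L → γ' ∈ L

/-- Every execution, from whatever configuration, contains a configuration of `L`. -/
def Converges [Fintype V] (P : Program S) (G : SimpleGraph V) (L : Set (V → S)) : Prop :=
  ∀ e : P.Execution G, ∃ i, e.conf i ∈ L

/-- `L` is a set of legitimate configurations for the specification `SP`: a non-empty attractor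
such that every execution that starts in `L` satisfies `SP`. -/
def IsLegitimate [Fintype V] (P : Program S) (G : SimpleGraph V) (SP : P.Execution G → Prop)
    (L : Set (V → S)) : Prop :=
  L.Nonempty ∧ P.Closed G L ∧ P.Converges G L ∧ ∀ e : P.Execution G, e.conf 0 ∈ L → SP e

/-- The algorithm is self-stabilizing for the specification `SP`. -/
def SelfStabilizing [Fintype V] (P : Program S) (G : SimpleGraph V)
    (SP : P.Execution G → Prop) : Prop :=
  ∃ L : Set (V → S), P.IsLegitimate G SP L

/-- The stabilization time in moves with respect to the legitimate configurations `L`: the supremum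
over all executions of the number of moves before the first configuration in `L` (it is `⊤` if an
execution never reaches `L`). -/
noncomputable def stabilizationMoves [Fintype V] (P : Program S) (G : SimpleGraph V)
    (L : Set (V → S)) : ℕ∞ :=
  ⨆ e : P.Execution G, ⨅ i : ℕ, ⨅ _ : e.conf i ∈ L, (e.moves i : ℕ∞)

end Program

/-! ### The reset algorithm SDR -/

/-- The status of a process with respect to a reset: correct, broadcast, feedback. -/
inductive Status
  | C
  | RB
  | RF

/-- The local state of a process: the two variables of SDR, and the state `inp` of the process in
the input algorithm. -/
structure RState (I : Type*) where
  st : Status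
  d : ℕ
  inp : I

/-- What the input algorithm provides to SDR: the predicates `P_ICorrect` (on the own state and the
states of the neighbours in the input algorithm) and `P_reset`, and the macro `reset`. -/
structure SDRInput (I : Type*) where
  ICorrect : I → Multiset I → Prop
  Reset : I → Prop
  reset : I → I

namespace SDR

variable {I : Type*}

/-! In the predicates, `s` is the state of the process and `N` the states of its neighbours, so
that `s ::ₘ N` lists the states of the closed neighbourhood. -/

def PICorrect (A : SDRInput I) (s : RState I) (N : Multiset (RState I)) : Prop :=
  A.ICorrect s.inp (N.map RState.inp)

def PCorrect (A : SDRInput I) (s : RState I) (N : Multiset (RState I)) : Prop :=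
  s.st = Status.C → PICorrect A s N

def PClean (s : RState I) (N : Multiset (RState I)) : Prop :=
  ∀ t ∈ s ::ₘ N, t.st = Status.C

def PR1 (A : SDRInput I) (s : RState I) (N : Multiset (RState I)) : Prop :=
  s.st = Status.C ∧ ¬ A.Reset s.inp ∧ ∃ t ∈ N, t.st = Status.RF

def PRB (s : RState I) (N : Multiset (RState I)) : Prop :=
  s.st = Status.C ∧ ∃ t ∈ N, t.st = Status.RB

def PRF (A : SDRInput I) (s : RState I) (N : Multiset (RState I)) : Prop :=
  s.st = Status.RB ∧ A.Reset s.inp ∧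
    ∀ t ∈ N, (t.st = Status.RB ∧ t.d ≤ s.d) ∨ (t.st = Status.RF ∧ A.Reset t.inp)

def PC (A : SDRInput I) (s : RState I) (N : Multiset (RState I)) : Prop :=
  s.st = Status.RF ∧
    ∀ t ∈ s ::ₘ N, A.Reset t.inp ∧ ((t.st = Status.RF ∧ s.d ≤ t.d) ∨ t.st = Status.C)

def PR2 (A : SDRInput I) (s : RState I) : Prop :=
  s.st ≠ Status.C ∧ ¬ A.Reset s.inp

def PUp (A : SDRInput I) (s : RState I) (N : Multiset (RState I)) : Prop :=
  ¬ PRB s N ∧ (PR1 A s N ∨ PR2 A s ∨ ¬ PCorrect A s N)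

/-- The least distance of a neighbour of status `RB` (there is one where this value is used). -/
noncomputable def minDist (N : Multiset (RState I)) : ℕ :=
  sInf {k | ∃ t ∈ N, t.st = Status.RB ∧ t.d = k}

/-- The labels of `rule_RB`, `rule_RF`, `rule_C` and `rule_R`. -/
inductive Rule
  | RB
  | RF
  | C
  | R

/-- Algorithm SDR. -/
noncomputable def program (A : SDRInput I) : Program (RState I) where
  Rule := Rule
  guard
    | Rule.RB, s, N => PRB s N
    | Rule.RF, s, N => PRF A s N
    | Rule.C, s, N => PC A s N
    | Rule.R, s, N => PUp A s N
  action
    | Rule.RB, s, N => ⟨Status.RB, minDist N + 1, A.reset s.inp⟩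
    | Rule.RF, s, _ => { s with st := Status.RF }
    | Rule.C, s, _ => { s with st := Status.C }
    | Rule.R, s, _ => ⟨Status.RB, 0, A.reset s.inp⟩

/-- Normal configurations: `P_Clean` and `P_ICorrect` hold at every process. -/
def normal {V : Type*} [Fintype V] (A : SDRInput I) (G : SimpleGraph V) : Set (V → RState I) :=
  {γ | ∀ u, PClean (γ u) (Program.view G γ u) ∧ PICorrect A (γ u) (Program.view G γ u)}

end SDR

/-! ### The unison algorithm U, with clocks modulo `K` -/

namespace Unison

/-- The clocks of two neighbours differ by at most one increment modulo `K`. -/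
def POk {K : ℕ} (c c' : ZMod K) : Prop :=
  c' = c - 1 ∨ c' = c ∨ c' = c + 1

/-- The inputs that U provides to SDR. -/
def input (K : ℕ) : SDRInput (ZMod K) where
  ICorrect c N := ∀ c' ∈ N, POk c c'
  Reset c := c = 0
  reset _ := 0

/-- A clock can be incremented if it is on time or one increment late with each neighbour. -/
def PUp {K : ℕ} (s : RState (ZMod K)) (N : Multiset (RState (ZMod K))) : Prop :=
  ∀ t ∈ N, t.inp = s.inp ∨ t.inp = s.inp + 1

/-- Algorithm U, with its single rule `rule_U`. -/
def program (K : ℕ) : Program (RState (ZMod K)) where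
  Rule := Unit
  guard _ s N := SDR.PClean s N ∧ PUp s N
  action _ s _ := { s with inp := s.inp + 1 }

/-- The composition U ∘ SDR. -/
noncomputable def composed (K : ℕ) : Program (RState (ZMod K)) :=
  (program K).comp (SDR.program (input K))

/-- The specification of unison. Safety: at each instant the clocks of two neighbours differ by at
most one increment. Liveness: each process increments its clock infinitely often. -/
def Spec {V : Type*} [Fintype V] {K : ℕ} {P : Program (RState (ZMod K))} {G : SimpleGraph V}
    (e : P.Execution G) : Prop :=
  (∀ i u v, G.Adj u v → POk (e.conf i u).inp (e.conf i v).inp) ∧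
  (∀ u i, ∃ j, i ≤ j ∧ (e.conf (j + 1) u).inp = (e.conf j u).inp + 1)

end Unison

namespace Program

variable {V S : Type*} [Fintype V]

/-! An alive root is a process that must start a reset, or an `RB` process whose distance is least
among its `RB` neighbours. No step creates one (`Transition.isAliveRoot`), so their number never
increases. The execution is thus cut into at most n + 1 segments on which this number is constant,
hence on which the set of alive roots is constant.

Within a segment, the branches hanging from alive roots persist (`InAliveBranch.transition`): a
process that has joined a reset and fed back stays blocked by its parent. A process can therefore at
most clean up an old reset, join or start a new one, and feed back: three moves of SDR
(`segmentPotential`). One last cleaning remains once no alive root is left, so each process makes at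
most 3n + 1 moves of SDR (`resetMoves_le`).

Within a segment the numbers of clock increments of two neighbours differ by at most 2
(`ticks_le_of_adj`), hence by at most 2D between any two processes. An alive root never increments,
so while there is one every process increments at most 2D times. When there is none and the
configuration is not yet normal, some process is still `RF` and has not incremented, so the others
again increment at most 2D times. The total is n(2Dn + 3n + 1) + 2D(n - 1) = (2D + 3)n² + (2D + 1)(n
- 1) + 1, which is stronger than the bound with 3D.

A configuration that is not normal is never terminal, so the bound on moves forces convergence. In
normal configurations there is no alive root: a process that stopped incrementing would bound the
increments of all others, while K > n excludes deadlock. -/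

@[simp]
theorem mem_view {G : SimpleGraph V} {γ : V → S} {u : V} {s : S} :
    s ∈ view G γ u ↔ ∃ v, G.Adj u v ∧ γ v = s := by
  simp [view]

end Program

/-! ### Alive roots and local moves. -/

namespace Unison

variable {V : Type*} {K : ℕ}

/-- The process must start a reset: the guard of `rule_R`. -/
def MustReset (G : SimpleGraph V) (γ : V → RState (ZMod K)) (u : V) : Prop :=
  ¬ ((γ u).st = Status.C ∧ ∃ v, G.Adj u v ∧ (γ v).st = Status.RB) ∧
  (((γ u).st = Status.C ∧ (γ u).inp ≠ 0 ∧ ∃ v, G.Adj u v ∧ (γ v).st = Status.RF) ∨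
    ((γ u).st ≠ Status.C ∧ (γ u).inp ≠ 0) ∨
    ((γ u).st = Status.C ∧ ∃ v, G.Adj u v ∧ ¬ POk (γ u).inp (γ v).inp))

/-- The process broadcasts a reset and has no neighbour that does so at a smaller distance. -/
def IsBroadcastRoot (G : SimpleGraph V) (γ : V → RState (ZMod K)) (u : V) : Prop :=
  (γ u).st = Status.RB ∧ ∀ v, G.Adj u v → (γ v).st = Status.RB → (γ u).d ≤ (γ v).d

/-- The process is the origin of a reset, ongoing or about to start. -/
def IsAliveRoot (G : SimpleGraph V) (γ : V → RState (ZMod K)) (u : V) : Prop :=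
  MustReset G γ u ∨ IsBroadcastRoot G γ u

/-- The ways in which a process `u` can go from its state in `γ` to the state `s` by executing
the rule `r` (if any). -/
inductive LocalMove (G : SimpleGraph V) (γ : V → RState (ZMod K)) (u : V)
    (r : Option (Unit ⊕ SDR.Rule)) (s : RState (ZMod K)) : Prop
  | idle (hr : r = none) (hs : s = γ u)
  | tick (hr : r = some (Sum.inl ())) (hC : (γ u).st = Status.C)
      (hN : ∀ v, G.Adj u v → (γ v).st = Status.C)
      (hup : ∀ v, G.Adj u v → (γ v).inp = (γ u).inp ∨ (γ v).inp = (γ u).inp + 1)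
      (hst : s.st = Status.C) (hd : s.d = (γ u).d) (hinp : s.inp = (γ u).inp + 1)
  | broadcast (hr : r = some (Sum.inr SDR.Rule.RB)) (hC : (γ u).st = Status.C) (v : V)
      (huv : G.Adj u v) (hv : (γ v).st = Status.RB)
      (hst : s.st = Status.RB) (hd : s.d = (γ v).d + 1) (hinp : s.inp = 0)
  | feedback (hr : r = some (Sum.inr SDR.Rule.RF)) (hB : (γ u).st = Status.RB)
      (h0 : (γ u).inp = 0)
      (hN : ∀ v, G.Adj u v → ((γ v).st = Status.RB ∧ (γ v).d ≤ (γ u).d) ∨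
        ((γ v).st = Status.RF ∧ (γ v).inp = 0))
      (hst : s.st = Status.RF) (hd : s.d = (γ u).d) (hinp : s.inp = 0)
  | clean (hr : r = some (Sum.inr SDR.Rule.C)) (hF : (γ u).st = Status.RF)
      (h0 : (γ u).inp = 0)
      (hN : ∀ v, G.Adj u v → (γ v).inp = 0 ∧
        (((γ v).st = Status.RF ∧ (γ u).d ≤ (γ v).d) ∨ (γ v).st = Status.C))
      (hst : s.st = Status.C) (hd : s.d = (γ u).d) (hinp : s.inp = 0)
  | root (hr : r = some (Sum.inr SDR.Rule.R)) (hR : MustReset G γ u)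
      (hst : s.st = Status.RB) (hd : s.d = 0) (hinp : s.inp = 0)

/-- Every process makes a local move, possibly idle. -/
def Transition (G : SimpleGraph V) (γ : V → RState (ZMod K)) (a : V → Option (Unit ⊕ SDR.Rule))
    (γ' : V → RState (ZMod K)) : Prop :=
  ∀ u, LocalMove G γ u (a u) (γ' u)

/-! ### From the rules to local moves, and absence of deadlock. -/

section

variable [Fintype V] {G : SimpleGraph V} {γ γ' : V → RState (ZMod K)}
  {a : V → Option (Unit ⊕ SDR.Rule)} {u : V}

theorem PUp_view_iff :
    SDR.PUp (input K) (γ u) (Program.view G γ u) ↔ MustReset G γ u := by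
  simp only [SDR.PUp, SDR.PRB, SDR.PR1, SDR.PR2, SDR.PCorrect, SDR.PICorrect, input, MustReset,
    Program.mem_view, Multiset.mem_map]
  have h₁ : ∀ p : RState (ZMod K) → Prop, (∃ t, (∃ v, G.Adj u v ∧ γ v = t) ∧ p t) ↔
      ∃ v, G.Adj u v ∧ p (γ v) := fun p => by
    constructor
    · rintro ⟨t, ⟨v, hv, rfl⟩, h⟩
      exact ⟨v, hv, h⟩
    · rintro ⟨v, hv, h⟩
      exact ⟨_, ⟨v, hv, rfl⟩, h⟩
  have h₂ : (¬ ((γ u).st = Status.C → ∀ c', (∃ t, (∃ v, G.Adj u v ∧ γ v = t) ∧ t.inp = c') →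
      POk (γ u).inp c')) ↔
      ((γ u).st = Status.C ∧ ∃ v, G.Adj u v ∧ ¬ POk (γ u).inp (γ v).inp) := by
    push Not
    refine and_congr_right fun _ => ?_
    constructor
    · rintro ⟨c, ⟨t, ⟨v, hv, rfl⟩, rfl⟩, h⟩
      exact ⟨v, hv, h⟩
    · rintro ⟨v, hv, h⟩
      exact ⟨_, ⟨_, ⟨v, hv, rfl⟩, rfl⟩, h⟩
  rw [h₂]
  simp only [h₁]

theorem exists_minDist (h : ∃ v, G.Adj u v ∧ (γ v).st = Status.RB) :
    ∃ v, G.Adj u v ∧ (γ v).st = Status.RB ∧ SDR.minDist (Program.view G γ u) = (γ v).d := by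
  obtain ⟨v, hv, hB⟩ := h
  have := Nat.sInf_mem (s := {k | ∃ t ∈ Program.view G γ u, t.st = Status.RB ∧ t.d = k})
    ⟨_, γ v, Program.mem_view.2 ⟨v, hv, rfl⟩, hB, rfl⟩
  obtain ⟨t, ht, htB, htd⟩ := this
  obtain ⟨w, hw, rfl⟩ := Program.mem_view.1 ht
  exact ⟨w, hw, htB, htd.symm⟩

/-- Minimality of the distance chosen by a broadcast is forgotten here: later arguments only need
that it exceeds the distance of some `RB` neighbour. -/
theorem transition_of_isStep (h : (composed K).IsStep G γ a γ') : Transition G γ a γ' := by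
  intro u
  obtain ⟨-, h₀, h₁⟩ := h
  rcases ha : a u with _ | r
  · exact .idle rfl (h₀ u ha)
  · obtain ⟨hen, hact⟩ := h₁ u r ha
    rcases r with ⟨⟩ | r
    · have hen : SDR.PClean (γ u) (Program.view G γ u) ∧ PUp (γ u) (Program.view G γ u) := hen
      have hact : γ' u = { γ u with inp := (γ u).inp + 1 } := hact
      simp only [SDR.PClean, PUp, Multiset.mem_cons, Program.mem_view] at hen
      have hC := hen.1 _ (Or.inl rfl)
      exact .tick rfl hC (fun v hv => hen.1 _ (Or.inr ⟨v, hv, rfl⟩))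
        (fun v hv => hen.2 _ ⟨v, hv, rfl⟩) (by rw [hact]; exact hC) (by rw [hact]) (by rw [hact])
    · cases r with
      | RB =>
        have hen : SDR.PRB (γ u) (Program.view G γ u) := hen
        have hact : γ' u = ⟨Status.RB, SDR.minDist (Program.view G γ u) + 1, 0⟩ := hact
        obtain ⟨hC, t, ht, hB⟩ := hen
        obtain ⟨v, hv, rfl⟩ := Program.mem_view.1 ht
        obtain ⟨w, hw, hwB, hd⟩ := exists_minDist (γ := γ) ⟨v, hv, hB⟩
        exact .broadcast rfl hC w hw hwB (by rw [hact]) (by rw [hact, hd]) (by rw [hact])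
      | RF =>
        have hen : SDR.PRF (input K) (γ u) (Program.view G γ u) := hen
        have hact : γ' u = { γ u with st := Status.RF } := hact
        obtain ⟨hB, h0, hN⟩ := hen
        have h0 : (γ u).inp = 0 := h0
        exact .feedback rfl hB h0 (fun v hv => hN _ (Program.mem_view.2 ⟨v, hv, rfl⟩))
          (by rw [hact]) (by rw [hact]) (by rw [hact]; exact h0)
      | C =>
        have hen : SDR.PC (input K) (γ u) (Program.view G γ u) := hen
        have hact : γ' u = { γ u with st := Status.C } := hact
        obtain ⟨hF, hN⟩ := hen
        have h0 : (γ u).inp = 0 := (hN _ (Multiset.mem_cons_self _ _)).1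
        exact .clean rfl hF h0
          (fun v hv => hN _ (Multiset.mem_cons_of_mem (Program.mem_view.2 ⟨v, hv, rfl⟩)))
          (by rw [hact]) (by rw [hact]) (by rw [hact]; exact h0)
      | R =>
        have hen : SDR.PUp (input K) (γ u) (Program.view G γ u) := hen
        have hact : γ' u = ⟨Status.RB, 0, 0⟩ := hact
        exact .root rfl (PUp_view_iff.1 hen) (by rw [hact]) (by rw [hact]) (by rw [hact])

/-- The rules executed in an execution of U ∘ SDR: the one of U or one of SDR. -/
def executedRule (e : (composed K).Execution G) : ℕ → V → Option (Unit ⊕ SDR.Rule) :=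
  e.rule

/-- A transition may be idle everywhere, so the repetition of a terminal configuration is covered as
well. -/
theorem Transition.of_execution (e : (composed K).Execution G) (i : ℕ) :
    Transition G (e.conf i) (executedRule e i) (e.conf (i + 1)) := by
  rcases e.step i with h | ⟨-, h, h'⟩
  · exact transition_of_isStep h
  · exact fun u => .idle (h u) (congrFun h' u)

theorem mem_normal_iff :
    γ ∈ SDR.normal (input K) G ↔ (∀ u, (γ u).st = Status.C) ∧
      ∀ u v, G.Adj u v → POk (γ u).inp (γ v).inp := by
  simp only [SDR.normal, SDR.PClean, SDR.PICorrect, input, Set.mem_ofPred_eq, Multiset.mem_cons,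
    Program.mem_view, Multiset.mem_map]
  constructor
  · intro h
    exact ⟨fun u => (h u).1 _ (Or.inl rfl), fun u v huv => (h u).2 _ ⟨_, ⟨v, huv, rfl⟩, rfl⟩⟩
  · rintro ⟨h₁, h₂⟩ u
    refine ⟨?_, ?_⟩
    · rintro t (rfl | ⟨v, -, rfl⟩) <;> exact h₁ _
    · rintro c ⟨t, ⟨v, hv, rfl⟩, rfl⟩
      exact h₂ u v hv

/-- In a configuration that is not normal some process can execute a rule of SDR. -/
theorem not_terminal_of_not_mem_normal (h : γ ∉ SDR.normal (input K) G) :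
    ¬ (composed K).Terminal G γ := by
  classical
  intro hT
  apply h
  have hR : ∀ u, ¬ MustReset G γ u := fun u hu =>
    hT u (Sum.inr SDR.Rule.R) (PUp_view_iff.2 hu)
  have hB : ∀ u v, (γ u).st = Status.C → G.Adj u v → (γ v).st ≠ Status.RB := fun u v hu huv hv =>
    hT u (Sum.inr SDR.Rule.RB) ⟨hu, γ v, Program.mem_view.2 ⟨v, huv, rfl⟩, hv⟩
  have h0 : ∀ u, (γ u).st ≠ Status.C → (γ u).inp = 0 := fun u hu => by
    by_contra h0
    exact hR u ⟨fun h => hu h.1, Or.inr (Or.inl ⟨hu, h0⟩)⟩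
  have noRB : ∀ u, (γ u).st ≠ Status.RB := by
    by_contra! ⟨u₀, hu₀⟩
    -- An `RB` process of largest distance can feed back: it has no `C` neighbour, as that one could
    -- join the reset.
    obtain ⟨u, hu, hmax⟩ := (Finset.univ.filter fun u => (γ u).st = Status.RB).exists_max_image
      (fun u => (γ u).d) ⟨u₀, by simpa using hu₀⟩
    simp only [Finset.mem_filter, Finset.mem_univ, true_and] at hu hmax
    refine hT u (Sum.inr SDR.Rule.RF) ⟨hu, h0 u (by simp [hu]), fun t ht => ?_⟩
    obtain ⟨v, hv, rfl⟩ := Program.mem_view.1 ht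
    cases hvs : (γ v).st with
    | C => exact absurd hu (hB v u hvs hv.symm)
    | RB => exact Or.inl ⟨rfl, hmax v hvs⟩
    | RF => exact Or.inr ⟨rfl, h0 v (by simp [hvs])⟩
  have noRF : ∀ u, (γ u).st ≠ Status.RF := by
    by_contra! ⟨u₀, hu₀⟩
    -- Without `RB` processes, an `RF` process of least distance can clean: a `C` neighbour with
    -- nonzero clock would have to reset.
    obtain ⟨u, hu, hmin⟩ := (Finset.univ.filter fun u => (γ u).st = Status.RF).exists_min_image
      (fun u => (γ u).d) ⟨u₀, by simpa using hu₀⟩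
    simp only [Finset.mem_filter, Finset.mem_univ, true_and] at hu hmin
    refine hT u (Sum.inr SDR.Rule.C) ⟨hu, fun t ht => ?_⟩
    rcases Multiset.mem_cons.1 ht with rfl | ht
    · exact ⟨h0 u (by simp [hu]), Or.inl ⟨hu, le_rfl⟩⟩
    obtain ⟨v, hv, rfl⟩ := Program.mem_view.1 ht
    cases hvs : (γ v).st with
    | C =>
      refine ⟨?_, Or.inr rfl⟩
      by_contra hv0
      exact hR v ⟨fun ⟨_, w, _, hw⟩ => noRB w hw, Or.inl ⟨hvs, hv0, u, hv.symm, hu⟩⟩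
    | RB => exact absurd hvs (noRB v)
    | RF => exact ⟨h0 v (by simp [hvs]), Or.inl ⟨rfl, hmin v hvs⟩⟩
  have hC : ∀ u, (γ u).st = Status.C := fun u => by
    cases hu : (γ u).st with
    | C => rfl
    | RB => exact absurd hu (noRB u)
    | RF => exact absurd hu (noRF u)
  refine mem_normal_iff.2 ⟨hC, fun u v huv => ?_⟩
  by_contra hok
  exact hR u ⟨fun ⟨_, w, _, hw⟩ => noRB w hw, Or.inr (Or.inr ⟨hC u, v, huv, hok⟩)⟩

/-- With more clock values than processes, a normal configuration is not terminal. -/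
theorem not_terminal_of_mem_normal [Nonempty V] (hK : Fintype.card V < K)
    (h : γ ∈ SDR.normal (input K) G) : ¬ (composed K).Terminal G γ := by
  intro hT
  obtain ⟨hC, hok⟩ := mem_normal_iff.1 h
  have : NeZero K := ⟨by omega⟩
  -- If nobody has the clock value preceding that of `u`, then `u` can increment. In a deadlock the
  -- set of clock values is thus closed under subtracting 1, so all K values occur among fewer than
  -- K processes.
  have hpred : ∀ u, ∃ v, (γ v).inp = (γ u).inp - 1 := by
    intro u
    by_contra! hu
    refine hT u (Sum.inl ()) ⟨fun t ht => ?_, fun t ht => ?_⟩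
    · rcases Multiset.mem_cons.1 ht with rfl | ht
      · exact hC u
      · obtain ⟨v, -, rfl⟩ := Program.mem_view.1 ht
        exact hC v
    · obtain ⟨v, hv, rfl⟩ := Program.mem_view.1 ht
      rcases hok u v hv with h | h
      · exact absurd h (hu v)
      · exact h
  obtain ⟨u₀⟩ := ‹Nonempty V›
  have hall : ∀ m : ℕ, ∃ v, (γ v).inp = (γ u₀).inp - m := by
    intro m
    induction m with
    | zero => exact ⟨u₀, by simp⟩
    | succ m ih =>
      obtain ⟨v, hv⟩ := ih
      obtain ⟨w, hw⟩ := hpred v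
      exact ⟨w, by rw [hw, hv]; push_cast; ring⟩
  have hsurj : Function.Surjective fun v => (γ v).inp := by
    intro c
    obtain ⟨v, hv⟩ := hall ((γ u₀).inp - c).val
    exact ⟨v, by simp [hv]⟩
  have := Fintype.card_le_of_surjective _ hsurj
  rw [ZMod.card] at this
  omega

end

/-! ### Persistence of alive roots and branches; moves of SDR within a segment. -/

section

variable {V : Type*} {K : ℕ} {G : SimpleGraph V} {γ γ' : V → RState (ZMod K)}
  {a : V → Option (Unit ⊕ SDR.Rule)} {u v : V}

theorem POk.symm {c c' : ZMod K} (h : POk c c') : POk c' c := by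
  rcases h with rfl | rfl | rfl
  · exact Or.inr (Or.inr (by ring))
  · exact Or.inr (Or.inl rfl)
  · exact Or.inl (by ring)

/-- The other two reasons for a reset need a status different from `C` at the process or at a
neighbour. -/
theorem MustReset.not_clean (h : MustReset G γ u) : (γ u).st = Status.C →
    (∀ v, G.Adj u v → (γ v).st = Status.C) →
    ∃ v, G.Adj u v ∧ ¬ POk (γ u).inp (γ v).inp := by
  intro hC hN
  rcases h.2 with ⟨-, -, v, hv, hF⟩ | ⟨h, -⟩ | ⟨-, h⟩
  · simp [hN v hv] at hF
  · exact absurd hC h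
  · exact h

/-- An alive root cannot increment its clock. -/
theorem LocalMove.ne_tick_of_isAliveRoot {r : Option (Unit ⊕ SDR.Rule)} {s : RState (ZMod K)}
    (h : LocalMove G γ u r s) (hu : IsAliveRoot G γ u) : r ≠ some (Sum.inl ()) := by
  rintro rfl
  rcases h with ⟨hr, -⟩ | ⟨-, hC, hN, hup, -⟩ | ⟨hr, -⟩ | ⟨hr, -⟩ | ⟨hr, -⟩ | ⟨hr, -⟩
  case tick =>
    rcases hu with hu | hu
    · obtain ⟨v, hv, hok⟩ := hu.not_clean hC hN
      exact hok (Or.inr (hup v hv))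
    · exact absurd hu.1 (by simp [hC])
  all_goals simp at hr

/-- A process of status `RB` keeps it as long as a neighbour is in the way of its feedback. -/
theorem Transition.st_eq_RB (h : Transition G γ a γ') (hv : (γ v).st = Status.RB)
    (hvu : G.Adj v u) (hu : (γ u).st = Status.C ∨ (γ u).st = Status.RB ∧ (γ v).d < (γ u).d) :
    (γ' v).st = Status.RB ∧ (γ' v).d ≤ (γ v).d := by
  rcases h v with ⟨hr, hs⟩ | ⟨hr, hC⟩ | ⟨hr, hC⟩ | ⟨hr, hB, h0, hN⟩ | ⟨hr, hF⟩ |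
    ⟨hr, hR, hst, hd, hinp⟩
  · simp [hs, hv]
  · simp [hv] at hC
  · simp [hv] at hC
  · have := hN u hvu
    grind
  · simp [hv] at hF
  · simp [hst, hd]

theorem not_mustReset_of_adj_RB (hu : (γ u).st = Status.C) (huv : G.Adj u v)
    (hv : (γ v).st = Status.RB) : ¬ MustReset G γ u :=
  fun h => h.1 ⟨hu, v, huv, hv⟩

/-- No alive root is created. -/
theorem Transition.isAliveRoot (h : Transition G γ a γ') (hu : IsAliveRoot G γ' u) :
    IsAliveRoot G γ u := by
  by_contra hn
  simp only [IsAliveRoot, not_or] at hn hu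
  obtain ⟨hn₁, hn₂⟩ := hn
  rcases h u with ⟨-, hs⟩ | ⟨-, hC, hN, hup, hst, hd, hinp⟩ | ⟨-, hC, v, huv, hv, hst, hd, hinp⟩ |
    ⟨-, hB, h0, hN, hst, hd, hinp⟩ | ⟨-, hF, h0, hN, hst, hd, hinp⟩ | ⟨-, hR, -⟩
  · cases hust : (γ u).st with
    | C =>
      rcases hu with hu | hu
      swap
      · exact absurd hu.1 (by simp [hs, hust])
      by_cases hRB : ∃ v, G.Adj u v ∧ (γ v).st = Status.RB
      · obtain ⟨v, huv, hv⟩ := hRB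
        exact not_mustReset_of_adj_RB (by rw [hs, hust]) huv
          (h.st_eq_RB hv huv.symm (Or.inl hust)).1 hu
      have hRB' : ∀ v, G.Adj u v → (γ' v).st ≠ Status.RB := fun v huv hv =>
        not_mustReset_of_adj_RB (by rw [hs, hust]) huv hv hu
      refine hn₁ ⟨fun h => hRB h.2, ?_⟩
      rcases hu.2 with ⟨-, hu0, v, huv, hv⟩ | ⟨hu, -⟩ | ⟨-, v, huv, hv⟩
      · refine Or.inl ⟨hust, by rwa [← hs], v, huv, ?_⟩
        have := hRB' v huv
        have : (γ v).st ≠ Status.RB := fun h => hRB ⟨v, huv, h⟩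
        rcases h v with ⟨-, hs⟩ | ⟨-, hC, hN, hup, hst, hd, hinp⟩ | ⟨-, hC, _, _, _, hst, hd, hinp⟩ |
          ⟨-, hB, h0, hN, hst, hd, hinp⟩ | ⟨-, hF, h0, hN, hst, hd, hinp⟩ | ⟨-, hR, hst, -⟩ <;>
          grind
      · simp [hs, hust] at hu
      · refine Or.inr (Or.inr ⟨hust, v, huv, fun hok => hv ?_⟩)
        have := hRB' v huv
        rcases h v with ⟨-, hs⟩ | ⟨-, hC, hN, hup, hst, hd, hinp⟩ | ⟨-, hC, _, _, _, hst, hd, hinp⟩ |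
          ⟨-, hB, h0, hN, hst, hd, hinp⟩ | ⟨-, hF, h0, hN, hst, hd, hinp⟩ | ⟨-, hR, hst, -⟩
        · rwa [‹γ' u = _›, hs]
        · rw [hs, hinp]
          refine POk.symm ?_
          rcases hup u huv.symm with h | h
          · exact Or.inl (by rw [h]; ring)
          · exact Or.inr (Or.inl h)
        · exact absurd hst this
        · exact absurd ⟨v, huv, hB⟩ hRB
        · rwa [hs, hinp, ← h0]
        · exact absurd hst this
    | RB =>
      obtain ⟨v, huv, hv, hd⟩ : ∃ v, G.Adj u v ∧ (γ v).st = Status.RB ∧ (γ v).d < (γ u).d := by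
        by_contra! hall
        exact hn₂ ⟨hust, hall⟩
      -- The closer `RB` neighbour cannot feed back before `u`, and its distance does not grow; so
      -- `u` does not become a broadcast root.
      have hv' := h.st_eq_RB hv huv.symm (Or.inr ⟨hust, hd⟩)
      rcases hu with hu | hu
      · refine hn₁ ⟨by simp [hust], Or.inr (Or.inl ⟨by simp [hust], ?_⟩)⟩
        have := hu.2
        simp only [hs, hust] at this
        grind
      · have := hu.2 v huv hv'.1
        rw [hs] at this
        omega
    | RF =>
      rcases hu with hu | hu
      · refine hn₁ ⟨by simp [hust], Or.inr (Or.inl ⟨by simp [hust], ?_⟩)⟩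
        have := hu.2
        simp only [hs, hust] at this
        grind
      · exact absurd hu.1 (by simp [hs, hust])
  · rcases hu with hu | hu
    swap
    · exact absurd hu.1 (by simp [hst])
    have hRB' : ∀ v, G.Adj u v → (γ' v).st ≠ Status.RB := fun v huv hv =>
      not_mustReset_of_adj_RB hst huv hv hu
    -- All neighbours were `C` and none is `RB` now, so each was idle or incremented too.
    have key : ∀ v, G.Adj u v → (γ' v).st = Status.C ∧ POk (γ' u).inp (γ' v).inp := by
      intro v huv
      have hv := hN v huv
      have hv' := hRB' v huv
      have hup₁ := hup v huv
      rcases h v with ⟨-, hs⟩ | ⟨-, _, _, hup, hst, _, hinp'⟩ | ⟨-, hC, _, _, _, hst, -⟩ |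
        ⟨-, hB, -⟩ | ⟨-, hF, -⟩ | ⟨-, hR, hst, -⟩
      · refine ⟨by rw [hs, hv], ?_⟩
        rw [hs, hinp]
        rcases hup₁ with h | h
        · exact Or.inl (by rw [h]; ring)
        · exact Or.inr (Or.inl h)
      · refine ⟨hst, ?_⟩
        rw [hinp, hinp']
        rcases hup₁ with h | h
        · exact Or.inr (Or.inl (by rw [h]))
        · exact Or.inr (Or.inr (by rw [h]))
      · exact absurd hst hv'
      · simp [hv] at hB
      · simp [hv] at hF
      · exact absurd hst hv'
    obtain ⟨v, huv, hok⟩ := hu.not_clean hst fun v hv => (key v hv).1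
    exact hok (key v huv).2
  · have hv' := h.st_eq_RB hv huv.symm (Or.inl hC)
    rcases hu with hu | hu
    · have := hu.2
      simp [hst, hinp] at this
    · have := hu.2 v huv hv'.1
      omega
  · rcases hu with hu | hu
    · have := hu.2
      simp [hst, hinp] at this
    · exact absurd hu.1 (by simp [hst])
  · rcases hu with hu | hu
    · have := hu.2
      simp only [hst, hinp, ne_eq, not_true_eq_false, false_and, and_false, true_and,
        false_or] at this
      obtain ⟨v, huv, hok⟩ := this
      apply hok
      -- After a cleaning at `u` all clocks around are still 0: no neighbour could increment next to
      -- the `RF` process `u`.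
      refine Or.inr (Or.inl ?_)
      have hv := hN v huv
      rcases h v with ⟨-, hs⟩ | ⟨-, _, hN, -⟩ | ⟨-, _, _, _, _, _, _, hinp⟩ |
        ⟨-, _, _, _, _, _, hinp⟩ | ⟨-, _, _, _, _, _, hinp⟩ | ⟨-, _, _, _, hinp⟩
      · rw [hs, hv.1]
      · simp [hN u huv.symm] at hF
      all_goals exact hinp
    · exact absurd hu.1 (by simp [hst])
  · exact hn₁ hR

/-- The process takes part in a reset whose origin is an alive root: distances decrease along a
path of processes in reset that ends at an alive root. -/
inductive InAliveBranch (G : SimpleGraph V) (γ : V → RState (ZMod K)) : V → Prop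
  | root {u : V} (hu : IsAliveRoot G γ u) (hst : (γ u).st ≠ Status.C) : InAliveBranch G γ u
  | child {u v : V} (huv : G.Adj u v) (hv : InAliveBranch G γ v) (hd : (γ v).d < (γ u).d)
      (hst : (γ u).st ≠ Status.C) (hB : (γ u).st = Status.RB → (γ v).st = Status.RB) :
      InAliveBranch G γ u

theorem InAliveBranch.st_ne_C (h : InAliveBranch G γ u) : (γ u).st ≠ Status.C := by
  cases h <;> assumption

theorem InAliveBranch.exists_isAliveRoot (h : InAliveBranch G γ u) : ∃ v, IsAliveRoot G γ v := by
  induction h with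
  | root hu => exact ⟨_, hu⟩
  | child _ _ _ _ _ ih => exact ih

/-- Descend to `RB` neighbours of smaller distance; the descent ends at a broadcast root. -/
theorem inAliveBranch_of_st_eq_RB (hu : (γ u).st = Status.RB) : InAliveBranch G γ u := by
  induction hd : (γ u).d using Nat.strong_induction_on generalizing u with
  | _ d ih =>
    by_cases h : ∃ v, G.Adj u v ∧ (γ v).st = Status.RB ∧ (γ v).d < (γ u).d
    · obtain ⟨v, huv, hv, hlt⟩ := h
      exact .child huv (ih _ (hd ▸ hlt) hv rfl) hlt (by simp [hu]) fun _ => hv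
    · push Not at h
      exact .root (Or.inr ⟨hu, h⟩) (by simp [hu])

/-- As long as no alive root disappears, the alive branches persist. -/
theorem InAliveBranch.transition (hu : InAliveBranch G γ u) (h : Transition G γ a γ')
    (hR : ∀ v, IsAliveRoot G γ v → IsAliveRoot G γ' v) : InAliveBranch G γ' u := by
  induction hu with
  | @root u hu hst =>
    refine .root (hR u hu) fun hC => ?_
    rcases h u with ⟨-, hs⟩ | ⟨-, hC', -⟩ | ⟨-, hC', -⟩ | ⟨-, _, _, _, hst', -⟩ |
      ⟨-, hF, h0, -⟩ | ⟨-, _, hst', -⟩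
    · exact hst (by rw [← hs, hC])
    · exact hst hC'
    · exact hst hC'
    · simp [hst'] at hC
    · rcases hu with hu | hu
      · have := hu.2
        simp [hF, h0] at this
      · exact absurd hu.1 (by simp [hF])
    · simp [hst'] at hC
  | @child u v huv hv hd hst hB ih =>
    have hvC := hv.st_ne_C
    have hvC' := ih.st_ne_C
    have hdv : (γ' v).d ≤ (γ v).d := by
      rcases h v with ⟨-, hs⟩ | ⟨-, hC', -⟩ | ⟨-, hC', -⟩ | ⟨-, _, _, _, _, hd, -⟩ |
        ⟨-, _, _, _, _, hd, -⟩ | ⟨-, _, _, hd, -⟩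
      · rw [hs]
      · exact absurd hC' hvC
      · exact absurd hC' hvC
      · exact hd.le
      · exact hd.le
      · rw [hd]
        exact Nat.zero_le _
    rcases h u with ⟨-, hs⟩ | ⟨-, hC', -⟩ | ⟨-, hC', -⟩ | ⟨-, _, _, _, hst', hd', -⟩ |
      ⟨-, hF, h0, hN, -⟩ | ⟨-, _, hst', -⟩
    · refine .child huv ih (by rw [hs]; omega) (by rwa [hs]) fun hB' => ?_
      rw [hs] at hB'
      exact (h.st_eq_RB (hB hB') huv.symm (Or.inr ⟨hB', hd⟩)).1
    · exact absurd hC' hst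
    · exact absurd hC' hst
    · exact .child huv ih (by omega) (by simp [hst']) (by simp [hst'])
    · have := hN v huv
      grind
    · exact inAliveBranch_of_st_eq_RB hst'

open Classical in
/-- A bound on the number of moves of SDR that the process can still make before an alive root
disappears. -/
noncomputable def segmentPotential (G : SimpleGraph V) (γ : V → RState (ZMod K)) (u : V) : ℕ :=
  -- The longest chain is cleaning (3), joining or starting a reset (2), feedback (1). An `RF`
  -- process with clock 0 in an alive branch is blocked (0). A nonzero clock outside status `C`
  -- calls for a restart, which leaves only the feedback.
  match (γ u).st with
  | Status.C => 2
  | Status.RB => if (γ u).inp = 0 then 1 else 2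
  | Status.RF => if (γ u).inp = 0 then (if InAliveBranch G γ u then 0 else 3) else 2

theorem segmentPotential_le_three : segmentPotential G γ u ≤ 3 := by
  unfold segmentPotential
  grind

/-- The process executes a rule of SDR. -/
def IsResetMove (r : Option (Unit ⊕ SDR.Rule)) : Prop :=
  ∃ ρ, r = some (Sum.inr ρ)

/-- An `RF` process with clock 0 is not an alive root, so it has a parent in its branch; this parent
forbids the cleaning rule. -/
theorem InAliveBranch.not_clean (hu : InAliveBranch G γ u) (hF : (γ u).st = Status.RF)
    (h0 : (γ u).inp = 0) :
    ∃ v, G.Adj u v ∧ (γ v).st ≠ Status.C ∧ (γ v).d < (γ u).d := by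
  rcases hu with ⟨hu, -⟩ | ⟨huv, hv, hd⟩
  · rcases hu with hu | hu
    · have := hu.2
      simp [hF, h0] at this
    · exact absurd hu.1 (by simp [hF])
  · exact ⟨_, huv, hv.st_ne_C, hd⟩

theorem Transition.segmentPotential_pos (h : Transition G γ a γ') (hu : IsResetMove (a u)) :
    1 ≤ segmentPotential G γ u := by
  by_contra! h0
  have : (γ u).st = Status.RF ∧ (γ u).inp = 0 ∧ InAliveBranch G γ u := by
    unfold segmentPotential at h0
    grind
  obtain ⟨hF, h0, hA⟩ := this
  obtain ⟨v, huv, hvC, hd⟩ := hA.not_clean hF h0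
  obtain ⟨ρ, hρ⟩ := hu
  rcases h u with ⟨hr, -⟩ | ⟨hr, -⟩ | ⟨hr, hC, -⟩ | ⟨hr, hB, -⟩ | ⟨-, _, _, hN, -⟩ | ⟨-, hR, -⟩
  · simp [hρ] at hr
  · simp [hρ] at hr
  · simp [hF] at hC
  · simp [hF] at hB
  · have := hN v huv
    grind
  · have := hR.2
    simp [hF, h0] at this

open Classical in
-- The value 0 is preserved because alive branches persist, and a feedback reaches it because every
-- `RB` process lies in an alive branch.
theorem Transition.segmentPotential_le (h : Transition G γ a γ')
    (hR : ∀ v, IsAliveRoot G γ v → IsAliveRoot G γ' v) :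
    segmentPotential G γ' u + (if IsResetMove (a u) then 1 else 0) ≤ segmentPotential G γ u := by
  have hA := fun hu => InAliveBranch.transition (u := u) hu h hR
  have hpos := h.segmentPotential_pos (u := u)
  have hdef := segmentPotential.eq_def G γ u
  have hdef' := segmentPotential.eq_def G γ' u
  have hAC := fun hu => InAliveBranch.st_ne_C (G := G) (γ := γ') (u := u) hu
  have hmove : IsResetMove (a u) ↔ ∃ ρ, a u = some (Sum.inr ρ) := Iff.rfl
  rcases h u with ⟨hr, hs⟩ | ⟨hr, hC, hN, hup, hst, hd, hinp⟩ |
    ⟨hr, hC, v, huv, hv, hst, hd, hinp⟩ | ⟨hr, hB, h0, hN, hst, hd, hinp⟩ |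
    ⟨hr, hF, h0, hN, hst, hd, hinp⟩ | ⟨hr, hR', hst, hd, hinp⟩
  · simp only [hr, reduceCtorEq, exists_false] at hmove
    rw [hs] at hdef'
    grind
  · simp only [hr, Option.some.injEq, reduceCtorEq, exists_false] at hmove
    grind
  · grind
  · have := hA (inAliveBranch_of_st_eq_RB hB)
    grind
  · grind
  · have := hR'.2
    grind

end

/-! ### Clock increments within a segment. -/

section

variable {V : Type*} {K : ℕ} {G : SimpleGraph V} {γ γ' : V → RState (ZMod K)}
  {a : V → Option (Unit ⊕ SDR.Rule)} {u v : V}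

open Classical in
/-- The number of increments of the clock of `u` in the steps from `i` to `j - 1`. -/
noncomputable def ticks (rule : ℕ → V → Option (Unit ⊕ SDR.Rule)) (u : V) (i j : ℕ) : ℕ :=
  ((Finset.Ico i j).filter fun t => rule t u = some (Sum.inl ())).card

open Classical in
theorem ticks_succ {rule : ℕ → V → Option (Unit ⊕ SDR.Rule)} {i j : ℕ} (h : i ≤ j) :
    ticks rule u i (j + 1) =
      ticks rule u i j + if rule j u = some (Sum.inl ()) then 1 else 0 := by
  unfold ticks
  simp only [Finset.card_filter]
  exact Finset.sum_Ico_succ_top h _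

theorem ticks_eq_zero {rule : ℕ → V → Option (Unit ⊕ SDR.Rule)} {i j : ℕ}
    (h : ∀ t, i ≤ t → t < j → rule t u ≠ some (Sum.inl ())) :
    ticks rule u i j = 0 := by
  classical
  simp only [ticks, Finset.card_eq_zero, Finset.filter_eq_empty_iff, Finset.mem_Ico]
  exact fun t ht => h t ht.1 ht.2

/-- For K at least 3, the residue -1 differs from 0 and from 1. -/
theorem nonneg_of_intCast_eq (hK : 3 ≤ K) {δ : ℤ} (h : -1 ≤ δ)
    (hδ : (δ : ZMod K) = 0 ∨ (δ : ZMod K) = 1) : 0 ≤ δ := by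
  by_contra! hneg
  obtain rfl : δ = -1 := by omega
  push_cast at hδ
  rcases hδ with h | h
  · have : ((1 : ℕ) : ZMod K) = 0 := by
      push_cast
      linear_combination -h
    have := Nat.le_of_dvd one_pos ((ZMod.natCast_eq_zero_iff 1 K).1 this)
    omega
  · have : ((2 : ℕ) : ZMod K) = 0 := by
      push_cast
      linear_combination -h
    have := Nat.le_of_dvd two_pos ((ZMod.natCast_eq_zero_iff 2 K).1 this)
    omega

theorem nonpos_of_intCast_eq (hK : 3 ≤ K) {δ : ℤ} (h : δ ≤ 1)
    (hδ : (δ : ZMod K) = 0 ∨ (δ : ZMod K) = -1) : δ ≤ 0 := by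
  have := nonneg_of_intCast_eq hK (δ := -δ) (by omega) (by
    push_cast
    rcases hδ with h | h
    · exact Or.inl (by rw [h, neg_zero])
    · exact Or.inr (by rw [h, neg_neg]))
  omega

/-- The clock of `u` was incremented `x` times and that of its neighbour `v` was incremented `y`
times, and unless one of them takes part in a reset, the difference of the clocks is at most one
and accounts for `x - y`. -/
def Drift (G : SimpleGraph V) (γ : V → RState (ZMod K)) (u v : V) (x y : ℕ) : Prop :=
  x ≤ y + 2 ∧ (InAliveBranch G γ u ∨ InAliveBranch G γ v ∨ x = 0 ∨
    ∃ δ : ℤ, -1 ≤ δ ∧ δ ≤ 1 ∧ (γ v).inp - (γ u).inp = δ ∧ x + δ ≤ y + 1)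

open Classical in
-- Feedback and cleaning require the clock to be 0 already; only the moves to `RB` overwrite it.
theorem Transition.inp_eq (h : Transition G γ a γ') (u : V) : (γ' u).st = Status.RB ∨
    (γ' u).inp = (γ u).inp + if a u = some (Sum.inl ()) then 1 else 0 := by
  rcases h u with ⟨hr, hs⟩ | ⟨hr, -, -, -, -, -, hinp⟩ | ⟨-, -, _, -, -, hst, -⟩ |
    ⟨hr, _, h0, _, _, _, hinp⟩ | ⟨hr, _, h0, _, _, _, hinp⟩ | ⟨-, _, hst, -⟩
  · exact Or.inr (by simp [hr, hs])
  · exact Or.inr (by simp [hr, hinp])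
  · exact Or.inl hst
  · exact Or.inr (by simp [hr, h0, hinp])
  · exact Or.inr (by simp [hr, h0, hinp])
  · exact Or.inl hst

theorem Transition.tick (h : Transition G γ a γ') (hu : a u = some (Sum.inl ())) :
    (γ u).st = Status.C ∧ (∀ v, G.Adj u v → (γ v).st = Status.C) ∧
    (∀ v, G.Adj u v → (γ v).inp = (γ u).inp ∨ (γ v).inp = (γ u).inp + 1) := by
  rcases h u with ⟨hr, -⟩ | ⟨-, hC, hN, hup, -⟩ | ⟨hr, -⟩ | ⟨hr, -⟩ | ⟨hr, -⟩ | ⟨hr, -⟩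
  case tick => exact ⟨hC, hN, hup⟩
  all_goals simp [hu] at hr

theorem Transition.tick_right (h : Transition G γ a γ') (hv : a v = some (Sum.inl ()))
    (huv : G.Adj u v) : (γ u).inp = (γ v).inp ∨ (γ u).inp = (γ v).inp + 1 :=
  (h.tick hv).2.2 u huv.symm

open Classical in
-- An increment of `u` requires a clean neighbourhood and δ ≥ 0, hence x ≤ y + 1 beforehand unless x
-- = 0. Persistence of alive roots is not needed for this half of the invariant.
theorem Drift.transition_le {x y : ℕ} (hd : Drift G γ u v x y) (hK : 3 ≤ K)
    (h : Transition G γ a γ') (huv : G.Adj u v) :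
    x + (if a u = some (Sum.inl ()) then 1 else 0) ≤
      y + (if a v = some (Sum.inl ()) then 1 else 0) + 2 := by
  obtain ⟨hle, hd⟩ := hd
  split_ifs with hu hv <;> try omega
  obtain ⟨hC, hN, hup⟩ := h.tick hu
  rcases hd with hA | hA | rfl | ⟨δ, h₁, h₂, hδ, hxy⟩
  · exact absurd hC hA.st_ne_C
  · exact absurd (hN v huv) hA.st_ne_C
  · omega
  · have := nonneg_of_intCast_eq hK h₁ (by
      rw [← hδ]
      rcases hup v huv with h | h
      · exact Or.inl (by rw [h]; ring)
      · exact Or.inr (by rw [h]; ring))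
    omega

open Classical in
-- Initial clocks are arbitrary, but the first increment of `u` certifies that the two clocks are
-- close. From then on x + δ - y is invariant, until one of the two processes enters an alive
-- branch; this lasts for the rest of the segment and freezes both clocks.
theorem Drift.transition {x y : ℕ} (hd : Drift G γ u v x y) (hK : 3 ≤ K)
    (h : Transition G γ a γ') (huv : G.Adj u v)
    (hR : ∀ v, IsAliveRoot G γ v → IsAliveRoot G γ' v) :
    Drift G γ' u v (x + if a u = some (Sum.inl ()) then 1 else 0)
      (y + if a v = some (Sum.inl ()) then 1 else 0) := by
  refine ⟨hd.transition_le hK h huv, ?_⟩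
  rcases h.inp_eq u with hu | hu
  · exact Or.inl (inAliveBranch_of_st_eq_RB hu)
  rcases h.inp_eq v with hv | hv
  · exact Or.inr (Or.inl (inAliveBranch_of_st_eq_RB hv))
  rcases hd.2 with hA | hA | rfl | ⟨δ, h₁, h₂, hδ, hxy⟩
  · exact Or.inl (hA.transition h hR)
  · exact Or.inr (Or.inl (hA.transition h hR))
  · by_cases htu : a u = some (Sum.inl ())
    swap
    · exact Or.inr (Or.inr (Or.inl (by simp [htu])))
    refine Or.inr (Or.inr (Or.inr ?_))
    rw [hu, hv]
    obtain ⟨hC, hN, hup⟩ := h.tick htu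
    rcases hup v huv with h' | h' <;> by_cases htv : a v = some (Sum.inl ()) <;>
      simp only [htu, htv, if_true, if_false, h']
    · exact ⟨0, by omega, by omega, by push_cast; ring, by push_cast; omega⟩
    · exact ⟨-1, by omega, by omega, by push_cast; ring, by push_cast; omega⟩
    · have := nonpos_of_intCast_eq hK (δ := 1) le_rfl (by
        push_cast
        rcases h.tick_right htv huv with h | h
        · exact Or.inl (by linear_combination -h' - h)
        · exact Or.inr (by linear_combination -h' - h))
      omega
    · exact ⟨0, by omega, by omega, by push_cast; ring, by push_cast; omega⟩
  · refine Or.inr (Or.inr (Or.inr ?_))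
    rw [hu, hv]
    have hu' : a u = some (Sum.inl ()) → 0 ≤ δ := fun htu =>
      nonneg_of_intCast_eq hK h₁ (by
        rw [← hδ]
        rcases (h.tick htu).2.2 v huv with h | h
        · exact Or.inl (by rw [h]; ring)
        · exact Or.inr (by rw [h]; ring))
    have hv' : a v = some (Sum.inl ()) → δ ≤ 0 := fun htv =>
      nonpos_of_intCast_eq hK h₂ (by
        rw [← hδ]
        rcases h.tick_right htv huv with h | h
        · exact Or.inl (by rw [h]; ring)
        · exact Or.inr (by rw [h]; ring))
    by_cases htu : a u = some (Sum.inl ()) <;> by_cases htv : a v = some (Sum.inl ()) <;>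
      simp only [htu, htv, if_true, if_false, true_imp_iff] at hu' hv' ⊢
    · exact ⟨δ, h₁, h₂, by rw [← hδ]; ring, by push_cast; omega⟩
    · exact ⟨δ - 1, by omega, by omega, by push_cast; rw [← hδ]; ring, by push_cast; omega⟩
    · exact ⟨δ + 1, by omega, by omega, by push_cast; rw [← hδ]; ring, by push_cast; omega⟩
    · exact ⟨δ, h₁, h₂, by rw [← hδ]; ring, by push_cast; omega⟩

variable {conf : ℕ → V → RState (ZMod K)} {rule : ℕ → V → Option (Unit ⊕ SDR.Rule)} {i j : ℕ}

/-- While no alive root disappears, the numbers of increments of two neighbours differ by at most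
two. -/
theorem ticks_le_of_adj (hT : ∀ t, Transition G (conf t) (rule t) (conf (t + 1))) (hK : 3 ≤ K)
    (huv : G.Adj u v) (hR : ∀ t, i ≤ t → t + 1 < j → ∀ w, IsAliveRoot G (conf t) w →
      IsAliveRoot G (conf (t + 1)) w) :
    ticks rule u i j ≤ ticks rule v i j + 2 := by
  rcases Nat.lt_or_ge i j with hij | hij
  swap
  · simp [ticks, Finset.Ico_eq_empty_of_le hij]
  have key : ∀ t, i ≤ t → t < j → Drift G (conf t) u v (ticks rule u i t) (ticks rule v i t) := by
    intro t hit
    induction t, hit using Nat.le_induction with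
    | base => exact fun _ => ⟨by simp [ticks], Or.inr (Or.inr (Or.inl (by simp [ticks])))⟩
    | succ t hit ih =>
      intro htj
      rw [ticks_succ hit, ticks_succ hit]
      exact (ih (by omega)).transition hK (hT t) huv (hR t hit htj)
  -- The last step may destroy an alive root, so the full invariant stops at `j - 1`; only its
  -- inequality is carried over to `j`.
  obtain ⟨t, rfl⟩ : ∃ t, j = t + 1 := ⟨j - 1, by omega⟩
  rw [ticks_succ (by omega), ticks_succ (by omega)]
  exact (key t (by omega) (by omega)).transition_le hK (hT t) huv

theorem ticks_le_of_walk [Fintype V]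
    (hT : ∀ t, Transition G (conf t) (rule t) (conf (t + 1))) (hK : Fintype.card V < K)
    (hR : ∀ t, i ≤ t → t + 1 < j → ∀ w, IsAliveRoot G (conf t) w →
      IsAliveRoot G (conf (t + 1)) w) (p : G.Walk u v) :
    ticks rule u i j ≤ ticks rule v i j + 2 * p.length := by
  induction p with
  | nil => simp
  | cons h p ih =>
    -- An edge gives n ≥ 2, so K > n provides the K ≥ 3 needed for neighbours.
    have : 1 < Fintype.card V := Fintype.one_lt_card_iff.2 ⟨_, _, h.ne⟩
    have := ticks_le_of_adj hT (by omega) h hR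
    rw [SimpleGraph.Walk.length_cons]
    omega

theorem ticks_le_diam [Fintype V]
    (hT : ∀ t, Transition G (conf t) (rule t) (conf (t + 1))) (hK : Fintype.card V < K)
    (hG : G.Connected)
    (hR : ∀ t, i ≤ t → t + 1 < j → ∀ w, IsAliveRoot G (conf t) w →
      IsAliveRoot G (conf (t + 1)) w) (u v : V) :
    ticks rule u i j ≤ ticks rule v i j + 2 * G.diam := by
  have := hG.nonempty
  obtain ⟨p, hp⟩ := hG.exists_walk_length_eq_dist u v
  have h₁ := ticks_le_of_walk hT hK hR p
  have h₂ := SimpleGraph.dist_le_diam (SimpleGraph.connected_iff_ediam_ne_top.1 hG) (u := u)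
    (v := v)
  omega

end

/-! ### The number of alive roots, and bounds per process. -/

section

variable {V : Type*} {K : ℕ} {G : SimpleGraph V} {γ γ' : V → RState (ZMod K)}
  {a : V → Option (Unit ⊕ SDR.Rule)} {u v : V} {conf : ℕ → V → RState (ZMod K)}
  {rule : ℕ → V → Option (Unit ⊕ SDR.Rule)} {i j : ℕ} [Fintype V]

open Classical in
/-- The number of alive roots. -/
noncomputable def aliveRootCount (G : SimpleGraph V) (γ : V → RState (ZMod K)) : ℕ :=
  (Finset.univ.filter fun u => IsAliveRoot G γ u).card

theorem aliveRootCount_le : aliveRootCount G γ ≤ Fintype.card V :=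
  Finset.card_le_univ _

theorem aliveRootCount_eq_zero : aliveRootCount G γ = 0 ↔ ∀ u, ¬ IsAliveRoot G γ u := by
  simp [aliveRootCount, Finset.filter_eq_empty_iff]

theorem Transition.aliveRootCount_le (h : Transition G γ a γ') :
    aliveRootCount G γ' ≤ aliveRootCount G γ := by
  classical
  exact Finset.card_le_card (Finset.monotone_filter_right _ fun u _ hu => h.isAliveRoot hu)

theorem Transition.isAliveRoot_of_count_eq (h : Transition G γ a γ')
    (heq : aliveRootCount G γ' = aliveRootCount G γ) :
    ∀ v, IsAliveRoot G γ v → IsAliveRoot G γ' v := by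
  classical
  intro v hv
  have := Finset.eq_of_subset_of_card_le
    (Finset.monotone_filter_right Finset.univ fun u _ hu => h.isAliveRoot (u := u) hu) heq.ge
  have hv' : v ∈ Finset.univ.filter fun u => IsAliveRoot G γ u := by simpa using hv
  rw [← this] at hv'
  simpa using hv'

theorem st_ne_RB_of_count_eq_zero (h : aliveRootCount G γ = 0) (u : V) :
    (γ u).st ≠ Status.RB := fun hu =>
  let ⟨v, hv⟩ := (inAliveBranch_of_st_eq_RB hu).exists_isAliveRoot
  aliveRootCount_eq_zero.1 h v hv

/-- Without alive roots, the rule of SDR by which the status `RF` is left is the only one that is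
executed. -/
theorem Transition.of_count_eq_zero (h : Transition G γ a γ') (h0 : aliveRootCount G γ = 0)
    (u : V) : ((γ' u).st = (γ u).st ∧ ¬ IsResetMove (a u)) ∨
      ((γ u).st = Status.RF ∧ (γ' u).st = Status.C) := by
  have hB := st_ne_RB_of_count_eq_zero h0
  rcases h u with ⟨hr, hs⟩ | ⟨hr, hC, hN, hup, hst, hd, hinp⟩ | ⟨-, _, v, _, hv, -⟩ |
    ⟨-, hB', -⟩ | ⟨-, hF, _, _, hst, -⟩ | ⟨-, hR, -⟩
  · exact Or.inl ⟨by rw [hs], by simp [hr, IsResetMove]⟩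
  · exact Or.inl ⟨by rw [hst, hC], by simp [hr, IsResetMove]⟩
  · exact absurd hv (hB v)
  · exact absurd hB' (hB u)
  · exact Or.inr ⟨hF, hst⟩
  · exact absurd (Or.inl hR) (aliveRootCount_eq_zero.1 h0 u)

/-- If all statuses were `C`, two incompatible clocks would make an alive root. -/
theorem exists_st_ne_C (h : γ ∉ SDR.normal (input K) G) (h0 : aliveRootCount G γ = 0) :
    ∃ u, (γ u).st ≠ Status.C := by
  by_contra! hC
  refine h (mem_normal_iff.2 ⟨hC, fun u v huv => ?_⟩)
  by_contra hok
  exact aliveRootCount_eq_zero.1 h0 u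
    (Or.inl ⟨fun ⟨_, w, _, hw⟩ => by simp [hC w] at hw, Or.inr (Or.inr ⟨hC u, v, huv, hok⟩)⟩)

open Classical in
/-- A bound on the number of moves of SDR that the process can still make. -/
noncomputable def potential (G : SimpleGraph V) (γ : V → RState (ZMod K)) (u : V) : ℕ :=
  -- Three moves for each smaller positive number of alive roots, the current segment, and one final
  -- cleaning.
  if aliveRootCount G γ = 0 then (if (γ u).st = Status.C then 0 else 1)
  else 3 * (aliveRootCount G γ - 1) + segmentPotential G γ u + 1

theorem potential_le : potential G γ u ≤ 3 * Fintype.card V + 1 := by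
  have h₁ := aliveRootCount_le (G := G) (γ := γ)
  have h₂ := segmentPotential_le_three (G := G) (γ := γ) (u := u)
  unfold potential
  split_ifs <;> omega

open Classical in
theorem Transition.potential_le (h : Transition G γ a γ') (u : V) :
    potential G γ' u + (if IsResetMove (a u) then 1 else 0) ≤ potential G γ u := by
  have hle := h.aliveRootCount_le
  by_cases h0 : aliveRootCount G γ = 0
  · have h0' : aliveRootCount G γ' = 0 := by omega
    simp only [potential, h0, h0', if_true]
    rcases h.of_count_eq_zero h0 u with ⟨hst, hr⟩ | ⟨hF, hC⟩
    · simp [hst, hr]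
    · have hFC : (γ u).st ≠ Status.C := by simp [hF]
      simp only [hC, hFC, if_true, if_false]
      split_ifs <;> omega
  · by_cases heq : aliveRootCount G γ' = aliveRootCount G γ
    · have := h.segmentPotential_le (h.isAliveRoot_of_count_eq heq) (u := u)
      simp only [potential, heq, h0, if_false]
      omega
    · have hpos := h.segmentPotential_pos (u := u)
      have hle' := segmentPotential_le_three (G := G) (γ := γ') (u := u)
      -- The loss of an alive root pays for resetting the segment potential to at most 3; the move
      -- itself is paid by the old segment potential, which was positive.
      have : potential G γ' u ≤ 3 * (aliveRootCount G γ - 1) + 1 := by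
        unfold potential
        split_ifs <;> omega
      have hγ : potential G γ u = 3 * (aliveRootCount G γ - 1) + segmentPotential G γ u + 1 := by
        simp [potential, h0]
      split_ifs with hr
      · have := hpos hr
        omega
      · omega

open Classical in
theorem resetMoves_le (hT : ∀ t, Transition G (conf t) (rule t) (conf (t + 1))) (u : V) (j : ℕ) :
    ((Finset.range j).filter fun t => IsResetMove (rule t u)).card ≤ 3 * Fintype.card V + 1 := by
  have : ((Finset.range j).filter fun t => IsResetMove (rule t u)).card + potential G (conf j) u ≤
      potential G (conf 0) u := by
    induction j with
    | zero => simp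
    | succ j ih =>
      have := (hT j).potential_le u
      rw [Finset.card_filter] at ih ⊢
      rw [Finset.sum_range_succ]
      omega
  exact (Nat.le_of_add_right_le this).trans potential_le

/-- The indices below `j` at which an antitone sequence has a given value form an interval. -/
theorem exists_filter_eq_Ico {f : ℕ → ℕ} (hf : Antitone f) (k j : ℕ) :
    ∃ i l, ((Finset.range j).filter fun t => f t = k) = Finset.Ico i l := by
  rcases ((Finset.range j).filter fun t => f t = k).eq_empty_or_nonempty with h | h
  · exact ⟨0, 0, by simpa using h⟩
  refine ⟨Finset.min' _ h, Finset.max' _ h + 1, Finset.ext fun t => ⟨fun ht => Finset.mem_Ico.2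
    ⟨Finset.min'_le _ t ht, Nat.lt_succ_of_le (Finset.le_max' _ t ht)⟩, fun ht => ?_⟩⟩
  obtain ⟨h₁, h₂⟩ := Finset.mem_Ico.1 ht
  have hmin := Finset.min'_mem _ h
  have hmax := Finset.max'_mem _ h
  simp only [Finset.mem_filter, Finset.mem_range] at hmin hmax ⊢
  have h₃ := hf h₁
  have h₄ := hf (Nat.le_of_lt_succ h₂)
  omega

theorem isAliveRoot_succ_of_count_eq {k : ℕ}
    (hT : ∀ t, Transition G (conf t) (rule t) (conf (t + 1)))
    (hk : ∀ t, i ≤ t → t < j → aliveRootCount G (conf t) = k) :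
    ∀ t, i ≤ t → t + 1 < j → ∀ w, IsAliveRoot G (conf t) w →
    IsAliveRoot G (conf (t + 1)) w := fun t hit htj =>
  (hT t).isAliveRoot_of_count_eq ((hk (t + 1) (by omega) htj).trans (hk t hit (by omega)).symm)

/-- While an alive root exists and none disappears, a process increments its clock at most twice
the diameter times. -/
theorem ticks_le_of_count_pos {k : ℕ}
    (hT : ∀ t, Transition G (conf t) (rule t) (conf (t + 1)))
    (hk : ∀ t, i ≤ t → t < j → aliveRootCount G (conf t) = k)
    (hK : Fintype.card V < K) (hG : G.Connected) (hk0 : k ≠ 0) (u : V) :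
    ticks rule u i j ≤ 2 * G.diam := by
  rcases Nat.lt_or_ge i j with hij | hij
  swap
  · simp [ticks, Finset.Ico_eq_empty_of_le hij]
  have hR := isAliveRoot_succ_of_count_eq hT hk
  obtain ⟨r, hr⟩ : ∃ r, IsAliveRoot G (conf i) r := by
    by_contra! h
    exact hk0 ((hk i le_rfl hij).symm.trans (aliveRootCount_eq_zero.2 h))
  have hr' : ∀ t, i ≤ t → t < j → IsAliveRoot G (conf t) r := by
    intro t hit
    induction t, hit using Nat.le_induction with
    | base => exact fun _ => hr
    | succ t hit ih => exact fun htj => hR t hit htj r (ih (by omega))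
  have h0 : ticks rule r i j = 0 := ticks_eq_zero fun t hit htj =>
    (hT t r).ne_tick_of_isAliveRoot (hr' t hit htj)
  have := ticks_le_diam hT hK hG hR u r
  omega

/-- While no alive root exists and before a normal configuration, some process does not increment
its clock. -/
theorem exists_ticks_eq_zero [Nonempty V]
    (hT : ∀ t, Transition G (conf t) (rule t) (conf (t + 1)))
    (hk : ∀ t, i ≤ t → t < j → aliveRootCount G (conf t) = 0)
    (hn : ∀ t, i ≤ t → t < j → conf t ∉ SDR.normal (input K) G) : ∃ v, ticks rule v i j = 0 := by
  rcases Nat.lt_or_ge i j with hij | hij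
  swap
  · exact ⟨Classical.arbitrary V, by simp [ticks, Finset.Ico_eq_empty_of_le hij]⟩
  obtain ⟨l, rfl⟩ : ∃ l, j = l + 1 := ⟨j - 1, by omega⟩
  obtain ⟨v, hv⟩ := exists_st_ne_C (hn l (by omega) (by omega)) (hk l (by omega) (by omega))
  -- Status `C` is never left without alive roots. As `v` is not `C` at the end of the interval, it
  -- was never `C` in it and could not increment.
  have hstay : ∀ t, i ≤ t → (conf t v).st = Status.C → ∀ m, t ≤ m → m ≤ l →
      (conf m v).st = Status.C := by
    intro t hit hC m htm
    induction m, htm using Nat.le_induction with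
    | base => exact fun _ => hC
    | succ m htm ih =>
      intro hml
      rcases (hT m).of_count_eq_zero (hk m (by omega) (by omega)) v with h | h
      · rw [h.1, ih (by omega)]
      · exact h.2
  exact ⟨v, ticks_eq_zero fun t hit htl ht =>
    hv (hstay t hit ((hT t).tick ht).1 l (by omega) le_rfl)⟩

end

/-! ### The bound on moves, convergence, closure and liveness. -/

section

variable {V : Type*} {K : ℕ} {G : SimpleGraph V} {γ γ' : V → RState (ZMod K)}
  {a : V → Option (Unit ⊕ SDR.Rule)} {conf : ℕ → V → RState (ZMod K)}
  {rule : ℕ → V → Option (Unit ⊕ SDR.Rule)} [Fintype V]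

theorem aliveRootCount_antitone (hT : ∀ t, Transition G (conf t) (rule t) (conf (t + 1))) :
    Antitone fun t => aliveRootCount G (conf t) :=
  antitone_nat_of_succ_le fun t => (hT t).aliveRootCount_le

open Classical in
/-- Before a normal configuration, every process increments its clock at most `2 * D` times for
each positive number of alive roots, and all but one do so at most `2 * D` times more when there
is none. -/
theorem exists_ticks_le [Nonempty V] (hT : ∀ t, Transition G (conf t) (rule t) (conf (t + 1)))
    (hK : Fintype.card V < K) (hG : G.Connected) {j : ℕ}
    (hn : ∀ t, t < j → conf t ∉ SDR.normal (input K) G) :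
    ∃ v, ∀ u, ticks rule u 0 j ≤
      Fintype.card V * (2 * G.diam) + if u = v then 0 else 2 * G.diam := by
  -- The steps made with exactly `k` alive roots form the interval from `i k` to `l k`; only `k ≤ n`
  -- occurs.
  choose i l hil using exists_filter_eq_Ico (aliveRootCount_antitone (G := G) hT) (j := j)
  have hmem : ∀ k t, i k ≤ t → t < l k → t < j ∧ aliveRootCount G (conf t) = k := by
    intro k t h₁ h₂
    have := Finset.mem_Ico.2 ⟨h₁, h₂⟩
    rw [← hil] at this
    simpa using this
  have hsum : ∀ u, ticks rule u 0 j =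
      ∑ k ∈ Finset.range (Fintype.card V + 1), ticks rule u (i k) (l k) := by
    intro u
    rw [ticks, ← Finset.range_eq_Ico, Finset.card_eq_sum_card_fiberwise
      (f := fun t => aliveRootCount G (conf t)) (t := Finset.range (Fintype.card V + 1))]
    · refine Finset.sum_congr rfl fun k _ => ?_
      rw [ticks, ← hil, Finset.filter_comm]
    · intro t _
      exact Finset.mem_coe.2 (Finset.mem_range.2 (Nat.lt_succ_of_le aliveRootCount_le))
  have hk0 : ∀ t, i 0 ≤ t → t < l 0 → aliveRootCount G (conf t) = 0 :=
    fun t h₁ h₂ => (hmem 0 t h₁ h₂).2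
  obtain ⟨v, hv⟩ := exists_ticks_eq_zero hT hk0 fun t h₁ h₂ => hn t (hmem 0 t h₁ h₂).1
  refine ⟨v, fun u => ?_⟩
  rw [hsum, Finset.sum_range_succ']
  refine add_le_add ?_ ?_
  · have : ∀ k ∈ Finset.range (Fintype.card V),
        ticks rule u (i (k + 1)) (l (k + 1)) ≤ 2 * G.diam := fun k _ =>
      ticks_le_of_count_pos hT (fun t h₁ h₂ => (hmem _ t h₁ h₂).2) hK hG (Nat.succ_ne_zero k) u
    simpa using Finset.sum_le_card_nsmul _ _ _ this
  · split_ifs with huv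
    · rw [huv, hv]
    · have := ticks_le_diam hT hK hG (isAliveRoot_succ_of_count_eq hT hk0) u v
      omega

open Classical in
theorem moves_eq (e : (composed K).Execution G) (j : ℕ) :
    e.moves j = ∑ u, (ticks (executedRule e) u 0 j +
      ((Finset.range j).filter fun t => IsResetMove (executedRule e t u)).card) := by
  have hsplit : ∀ r : Option (Unit ⊕ SDR.Rule), (if r.isSome = true then 1 else 0) =
      (if r = some (Sum.inl ()) then 1 else 0) + if IsResetMove r then 1 else 0 := by
    rintro (_ | ⟨⟩ | ρ) <;> simp [IsResetMove]
  have hmoves : e.moves j = ∑ t ∈ Finset.range j,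
      (Finset.univ.filter fun u => (executedRule e t u).isSome = true).card := rfl
  simp only [hmoves, ticks, Finset.card_filter, ← Finset.sum_add_distrib, Finset.range_eq_Ico]
  rw [Finset.sum_comm]
  exact Finset.sum_congr rfl fun u _ => Finset.sum_congr rfl fun t _ => by convert hsplit _

/-- The bound on the number of moves before a normal configuration. -/
theorem moves_le (e : (composed K).Execution G) (hK : Fintype.card V < K) (hG : G.Connected)
    {j : ℕ} (hn : ∀ t, t < j → e.conf t ∉ SDR.normal (input K) G) :
    e.moves j ≤ (2 * G.diam + 3) * Fintype.card V ^ 2 +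
      (2 * G.diam + 1) * (Fintype.card V - 1) + 1 := by
  classical
  have := hG.nonempty
  have hT := Transition.of_execution e
  obtain ⟨v, hv⟩ := exists_ticks_le hT hK hG hn
  have hsum : e.moves j ≤ ∑ u, ((Fintype.card V * (2 * G.diam) + 3 * Fintype.card V + 1) +
      if u = v then 0 else 2 * G.diam) := by
    rw [moves_eq]
    refine Finset.sum_le_sum fun u _ => ?_
    have h₁ := hv u
    have h₂ := resetMoves_le hT u j
    omega
  refine hsum.trans (le_of_eq ?_)
  have hne : ∑ u : V, (if u = v then 0 else 2 * G.diam) = (Fintype.card V - 1) * (2 * G.diam) := by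
    rw [Finset.sum_ite, Finset.sum_const_zero, zero_add, Finset.sum_const, smul_eq_mul,
      Finset.filter_ne', Finset.card_erase_of_mem (Finset.mem_univ v), Finset.card_univ]
  rw [Finset.sum_add_distrib, hne, Finset.sum_const, smul_eq_mul, Finset.card_univ]
  obtain ⟨m, hm⟩ : ∃ m, Fintype.card V = m + 1 :=
    ⟨Fintype.card V - 1, by have := Fintype.card_pos (α := V); omega⟩
  rw [hm, Nat.add_sub_cancel]
  ring

theorem exists_executedRule_ne_none (e : (composed K).Execution G) {j : ℕ}
    (h : ¬ (composed K).Terminal G (e.conf j)) : ∃ u, executedRule e j u ≠ none := by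
  rcases e.step j with ⟨hu, -⟩ | ⟨hterm, -⟩
  · exact hu
  · exact absurd hterm h

theorem le_moves (e : (composed K).Execution G) {j : ℕ}
    (h : ∀ t, t < j → ¬ (composed K).Terminal G (e.conf t)) : j ≤ e.moves j := by
  have := Finset.card_nsmul_le_sum (Finset.range j)
    (fun t => (Finset.univ.filter fun u => (executedRule e t u).isSome = true).card) 1
    fun t ht => by
      obtain ⟨u, hu⟩ := exists_executedRule_ne_none e (h t (Finset.mem_range.1 ht))
      exact Finset.card_pos.2 ⟨u, by simpa [Option.isSome_iff_ne_none] using hu⟩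
  rw [smul_eq_mul, mul_one, Finset.card_range] at this
  exact this

theorem converges_normal (hK : Fintype.card V < K) (hG : G.Connected) :
    (composed K).Converges G (SDR.normal (input K) G) := by
  intro e
  by_contra! hn
  have h₁ := fun j => moves_le e hK hG (j := j) fun t _ => hn t
  have h₂ := fun j => le_moves e (j := j) fun t _ => not_terminal_of_not_mem_normal (hn t)
  -- Taken at an index one larger than the bound on moves.
  exact absurd ((h₂ _).trans (h₁ _)) (Nat.not_succ_le_self _)

theorem stabilizationMoves_le (hK : Fintype.card V < K) (hG : G.Connected) :
    (composed K).stabilizationMoves G (SDR.normal (input K) G) ≤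
      (((2 * G.diam + 3) * Fintype.card V ^ 2 +
        (2 * G.diam + 1) * (Fintype.card V - 1) + 1 : ℕ) : ℕ∞) := by
  classical
  refine iSup_le fun e => ?_
  have hex := converges_normal hK hG e
  refine (iInf₂_le (Nat.find hex) (Nat.find_spec hex)).trans ?_
  exact Nat.cast_le.2 (moves_le e hK hG fun t ht => Nat.find_min hex ht)

theorem normal_nonempty : (SDR.normal (input K) G).Nonempty :=
  ⟨fun _ => ⟨Status.C, 0, 0⟩, mem_normal_iff.2 ⟨fun _ => rfl, fun _ _ _ => Or.inr (Or.inl rfl)⟩⟩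

theorem aliveRootCount_eq_zero_of_mem_normal (h : γ ∈ SDR.normal (input K) G) :
    aliveRootCount G γ = 0 := by
  obtain ⟨hC, hok⟩ := mem_normal_iff.1 h
  refine aliveRootCount_eq_zero.2 fun u hu => ?_
  rcases hu with hu | hu
  · obtain ⟨v, huv, hv⟩ := hu.not_clean (hC u) fun v _ => hC v
    exact hv (hok u v huv)
  · exact absurd hu.1 (by simp [hC])

/-- Alive roots cannot appear, and without them status `C` is kept; with all statuses `C`, their
absence is normality. -/
theorem Transition.mem_normal (h : Transition G γ a γ') (hγ : γ ∈ SDR.normal (input K) G) :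
    γ' ∈ SDR.normal (input K) G := by
  have h0 := aliveRootCount_eq_zero_of_mem_normal hγ
  have h0' : aliveRootCount G γ' = 0 := Nat.le_zero.1 (h0 ▸ h.aliveRootCount_le)
  by_contra hn
  obtain ⟨u, hu⟩ := exists_st_ne_C hn h0'
  have hC := (mem_normal_iff.1 hγ).1 u
  rcases h.of_count_eq_zero h0 u with h | h
  · exact hu (h.1.trans hC)
  · exact hu h.2

theorem mem_normal_of_le (hT : ∀ t, Transition G (conf t) (rule t) (conf (t + 1)))
    (h : conf 0 ∈ SDR.normal (input K) G) (t : ℕ) : conf t ∈ SDR.normal (input K) G := by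
  induction t with
  | zero => exact h
  | succ t ih => exact (hT t).mem_normal ih

/-- After a normal configuration all processes increment their clocks infinitely often. -/
theorem exists_tick_of_mem_normal (e : (composed K).Execution G) (hK : Fintype.card V < K)
    (hG : G.Connected) (h : ∀ t, e.conf t ∈ SDR.normal (input K) G) (v : V) (i : ℕ) :
    ∃ t, i ≤ t ∧ executedRule e t v = some (Sum.inl ()) := by
  classical
  by_contra! hv
  have := hG.nonempty
  have hT := Transition.of_execution e
  have hticks : ∀ j u, ticks (executedRule e) u i j ≤ 2 * G.diam := by
    intro j u
    have h₁ := ticks_le_diam (i := i) (j := j) hT hK hG (isAliveRoot_succ_of_count_eq hT (k := 0)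
      fun t _ _ => aliveRootCount_eq_zero_of_mem_normal (h t)) u v
    have h₂ : ticks (executedRule e) v i j = 0 := ticks_eq_zero fun t hit _ => hv t hit
    omega
  -- A normal configuration is not terminal and admits only clock increments, so each step
  -- contributes at least one. This contradicts the uniform bound `hticks`.
  have hle : ∀ m, m ≤ ∑ u, ticks (executedRule e) u i (i + m) := by
    intro m
    induction m with
    | zero => exact Nat.zero_le _
    | succ m ih =>
      have hstep : 1 ≤ ∑ u, if executedRule e (i + m) u = some (Sum.inl ()) then 1 else 0 := by
        obtain ⟨u, hu⟩ := exists_executedRule_ne_none e (not_terminal_of_mem_normal hK (h (i + m)))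
        obtain ⟨r, hr⟩ := Option.ne_none_iff_exists'.1 hu
        have h0 := aliveRootCount_eq_zero_of_mem_normal (h (i + m))
        have hu : executedRule e (i + m) u = some (Sum.inl ()) := by
          rcases (hT (i + m)).of_count_eq_zero h0 u with h' | h'
          · rcases r with ⟨⟩ | ρ
            · exact hr
            · exact absurd ⟨ρ, hr⟩ h'.2
          · exact absurd h'.1 (by simp [(mem_normal_iff.1 (h (i + m))).1 u])
        refine le_trans (by rw [if_pos hu]) (Finset.single_le_sum
          (f := fun u => if executedRule e (i + m) u = some (Sum.inl ()) then 1 else 0)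
          (fun _ _ => Nat.zero_le _) (Finset.mem_univ u))
      rw [← add_assoc]
      simp only [ticks_succ (Nat.le_add_right i m), Finset.sum_add_distrib]
      omega
  have hlt : ∀ m, m ≤ Fintype.card V * (2 * G.diam) := fun m =>
    (hle m).trans (Finset.sum_le_card_nsmul _ _ _ fun u _ => hticks (i + m) u)
  exact absurd (hlt _) (Nat.not_succ_le_self _)

theorem spec_of_mem_normal (e : (composed K).Execution G) (hK : Fintype.card V < K)
    (hG : G.Connected) (h : e.conf 0 ∈ SDR.normal (input K) G) : Spec e := by
  have hT := Transition.of_execution e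
  have hn := mem_normal_of_le hT h
  refine ⟨fun i u v huv => (mem_normal_iff.1 (hn i)).2 u v huv, fun u i => ?_⟩
  obtain ⟨t, hit, ht⟩ := exists_tick_of_mem_normal e hK hG hn u i
  refine ⟨t, hit, ?_⟩
  rcases (hT t).inp_eq u with h' | h'
  · exact absurd h' (by simp [(mem_normal_iff.1 (hn (t + 1))).1 u])
  · rw [h', if_pos ht]

theorem isLegitimate_normal (hK : Fintype.card V < K) (hG : G.Connected) :
    (composed K).IsLegitimate G Spec (SDR.normal (input K) G) :=
  ⟨normal_nonempty, fun _ _ _ hs h => (transition_of_isStep hs).mem_normal h,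
    converges_normal hK hG, fun e h => spec_of_mem_normal e hK hG h⟩

end

end Unison

/-! ### The main theorem. -/

theorem mainTheorem5 :
    ∃ B : ℕ, ∀ (V : Type*) [Fintype V] (G : SimpleGraph V) (K : ℕ),
      G.Connected → Fintype.card V < K →
      (Unison.composed K).SelfStabilizing G Unison.Spec ∧
      (Unison.composed K).IsLegitimate G Unison.Spec (SDR.normal (Unison.input K) G) ∧
      (Unison.composed K).stabilizationMoves G (SDR.normal (Unison.input K) G) ≤
        (((3 * G.diam + 3) * Fintype.card V ^ 2 +
          (3 * G.diam + 1) * (Fintype.card V - 1) + 1 : ℕ) : ℕ∞) ∧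
      (2 ≤ Fintype.card V →
        (Unison.composed K).stabilizationMoves G (SDR.normal (Unison.input K) G) ≤
          ((B * (G.diam * Fintype.card V ^ 2) : ℕ) : ℕ∞)) := by
  -- For n ≥ 2 the diameter is at least 1, so 2D + 3 ≤ 5D and 2D + 1 ≤ 3D; already 8 would do.
  refine ⟨9, fun V _ G K hG hK => ⟨⟨_, Unison.isLegitimate_normal hK hG⟩,
    Unison.isLegitimate_normal hK hG, (Unison.stabilizationMoves_le hK hG).trans
      (Nat.cast_le.2 (by gcongr <;> omega)), fun hV =>
      (Unison.stabilizationMoves_le hK hG).trans (Nat.cast_le.2 ?_)⟩⟩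
  have : Nontrivial V := Fintype.one_lt_card_iff_nontrivial.1 hV
  have hD : 1 ≤ G.diam := Nat.one_le_iff_ne_zero.2
    (SimpleGraph.connected_iff_diam_ne_zero.1 hG)
  calc (2 * G.diam + 3) * Fintype.card V ^ 2 + (2 * G.diam + 1) * (Fintype.card V - 1) + 1
      ≤ (2 * G.diam + 3) * Fintype.card V ^ 2 + ((2 * G.diam + 1) * (Fintype.card V - 1) +
          (2 * G.diam + 1)) := by omega
    _ = (2 * G.diam + 3) * Fintype.card V ^ 2 + (2 * G.diam + 1) * Fintype.card V := by
        obtain ⟨m, hm⟩ : ∃ m, Fintype.card V = m + 1 := ⟨Fintype.card V - 1, by omega⟩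
        rw [hm, Nat.add_sub_cancel]
        ring
    _ ≤ (5 * G.diam) * Fintype.card V ^ 2 + (3 * G.diam) * Fintype.card V ^ 2 := by
        gcongr
        · omega
        · omega
        · exact Nat.le_self_pow two_ne_zero _
    _ ≤ 9 * (G.diam * Fintype.card V ^ 2) := by nlinarith
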